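/- Let $X=(X(u))_{u\ge 0}$ be a continuous-time Markov chain with right-continuous paths on a finite state space $E$, with generator matrix $P$, started in a stationary distribution $\pi$ for which it is reversible, i.e. $\pi_iP_{il}=\pi_lP_{li}$ for all $i,l$ (as is the case for the CSMA/CA chain, whose states are the sets of simultaneously transmitting links and in which each link that may start transmitting does so at rate $\nu$ and each transmission ends at rate $\mu$). Let $C>0$ and $k\ge 1$, and consider a flow crossing $k$ hops, where hop $j\in\{1,\dots,k\}$ transmits at rate $C$ while $X$ is in a set $F_j\subseteq E$ of favorable states and at rate $0$ otherwise. Thus hop $j$ has the impulse response $$S_j(s,t)=\int_s^t C\,\mathbf 1\{X(u)\in F_j\}\,du\qquad(s\le t\ \text{integers}),$$ and with a saturated source ($A(0)=0$ and $A(s)=\infty$ for $s\ge 1$) the end-to-end departure process is $D=A*S_1*\cdots*S_k$, where $(A*S)(t)=\min_{0\le s\le t}\{A(s)+S(s,t)\}$ over integers $s$; that is, $D(t)=\min_{0=u_0\le u_1\le\dots\le u_k=t}\sum_{j=1}^k S_j(u_{j-1},u_j)$ with integer $u_j$. No independence between the hops is assumed. For real $x$ let $B_j(x)=P-xC I_j$,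 where $I_j$ is the diagonal matrix with entry $1$ at the states of $F_j$ and $0$ elsewhere, and let $\lambda_j(x)$ be the largest real eigenvalue of $B_j(x)$. For $\theta>0$ put $$r_j(-k\theta)=\frac{\lambda_j(k\theta)}{-k\theta},\quad r(-k\theta)=\min_j r_j(-k\theta),\qquad r_j(k\theta)=\frac{\lambda_j(-k\theta)}{k\theta},\quad r(k\theta)=\max_j r_j(k\theta).$$ Let $\varepsilon>0$, let $t\ge 1$ be an integer, and for $\theta>0$ let $$\lambda^L_{t}(\theta)=r(-k\theta)+\frac{\log\varepsilon-\log\binom{t+k-1}{k-1}}{\theta t},\qquad \lambda^U_{t}(\theta)=r(k\theta)-\frac{\log\varepsilon}{\theta t},$$ $$\lambda^L_t=\sup_{\theta>0}\lambda^L_t(\theta),\qquad \lambda^U_t=\inf_{\theta>0}\lambda^U_t(\theta)$$ (the supremum and infimum taken in the extended reals). Then $\lambda_t^L$ and $\lambda_t^U$ are a probabilistic lower and a probabilistic upper bound on the capacity rate with violation probability $\varepsilon$: $$\mathbb P\bigl(D(t)<\lambda^L_t\,t\bigr)\le\varepsilon,\qquad \mathbb P\bigl(D(t)>\lambda^U_t\,t\bigr)\le\varepsilon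 .$$ Moreover, for every $\theta>0$, $$\mathbb P\bigl(D(t)\le\lambda^L_t(\theta)\,t\bigr)\le\varepsilon,\qquad \mathbb P\bigl(D(t)\ge\lambda^U_t(\theta)\,t\bigr)\le\varepsilon ,$$ so that the strict inequalities in the first two events may be replaced by non-strict ones whenever the supremum, respectively the infimum, is attained. -/

import Mathlib

open MeasureTheory Filter Topology
open scoped NNReal

/-- `P` is the generator matrix of a continuous-time Markov chain on the finite state space `E`. -/
structure IsGenerator {E : Type*} [Fintype E] (P : Matrix E E ℝ) : Prop where
  offDiag_nonneg : ∀ i l, i ≠ l → 0 ≤ P i l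
  row_sum : ∀ i, ∑ l, P i l = 0

/-- `p` is a probability vector in detailed balance with `P`; in particular it is a stationary
distribution of the chain with generator `P`. -/
structure IsReversibleDistribution {E : Type*} [Fintype E] (P : Matrix E E ℝ) (p : E → ℝ) :
    Prop where
  nonneg : ∀ i, 0 ≤ p i
  sum_eq_one : ∑ i, p i = 1
  detailed_balance : ∀ i l, p i * P i l = p l * P l i

/-- `X` is a continuous-time Markov chain with generator `P` and initial law `p`: its
finite-dimensional distributions are the ones given by `p` and the transition matrices `exp (t P)`,
and its paths are right-continuous for the discrete topology on the state space. -/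
structure IsMarkovChain {Ω E : Type*} [MeasurableSpace Ω] [Fintype E] [DecidableEq E]
    (μ : Measure Ω) (P : Matrix E E ℝ) (p : E → ℝ) (X : ℝ≥0 → Ω → E) : Prop where
  measurable_fiber : ∀ t i, MeasurableSet {ω | X t ω = i}
  right_continuous : ∀ ω t, ∀ᶠ u in 𝓝[>] t, X u ω = X t ω
  finite_dim : ∀ (n : ℕ) (t : Fin (n + 1) → ℝ≥0) (i : Fin (n + 1) → E), Monotone t →
    μ.real {ω | ∀ m, X (t m) ω = i m} =
      p (i 0) * ∏ m : Fin n,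
        NormedSpace.exp (((t m.succ : ℝ) - (t m.castSucc : ℝ)) • P) (i m.castSucc) (i m.succ)

noncomputable section

/-- The transmission rate in a state of the modulating chain: `C` in the favorable states `F`,
and `0` in the others. -/
def mmtpRate {E : Type*} (C : ℝ) (F : Set E) (i : E) : ℝ :=
  F.indicator (fun _ => C) i

/-- The impulse response `S(s,t)` of a link: the amount of data that the link, if saturated,
transmits between the slot boundaries `s` and `t`. -/
def impulseResponse {Ω E : Type*} (X : ℝ≥0 → Ω → E) (C : ℝ) (F : Set E) (ω : Ω) (s t : ℕ) : ℝ :=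
  ∫ u in (s : ℝ)..(t : ℝ), mmtpRate C F (X u.toNNReal ω)

/-- The `(min,+)` convolution `(A * S)(t) = min_{0 ≤ s ≤ t} (A(s) + S(s,t))`. -/
def minPlusConv (A : ℕ → EReal) (S : ℕ → ℕ → ℝ) (t : ℕ) : EReal :=
  (Finset.range (t + 1)).inf fun s => A s + (S s t : EReal)

/-- The departure process `A * S_1 * ⋯ * S_k` of a flow with arrival process `A` that crosses
`k` hops in series: the departures of each hop are the arrivals at the next one. -/
def departures (A : ℕ → EReal) : (k : ℕ) → (Fin k → ℕ → ℕ → ℝ) → ℕ → EReal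
  | 0, _ => A
  | k + 1, S => minPlusConv (departures A k fun j => S j.castSucc) (S (Fin.last k))

/-- The saturated source: no data up to time `0`, an infinite amount of data afterwards. -/
def saturatedArrivals (t : ℕ) : EReal :=
  if t = 0 then 0 else ⊤

/-- The cumulative end-to-end departures `D(t)` of a saturated flow that crosses `k` hops, the
`j`-th of which transmits at rate `C` while the chain `X` is in the set `F j`. -/
def endToEnd {Ω E : Type*} {k : ℕ} (X : ℝ≥0 → Ω → E) (C : ℝ) (F : Fin k → Set E)
    (t : ℕ) (ω : Ω) : EReal :=
  departures saturatedArrivals k (fun j => impulseResponse X C (F j) ω) t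

/-- The matrix `B = P - x C I`, where `I` is the diagonal 0-1 matrix of the favorable states. -/
def bMatrix {E : Type*} [DecidableEq E] (P : Matrix E E ℝ) (C : ℝ) (F : Set E) (x : ℝ) :
    Matrix E E ℝ :=
  P - (x * C) • Matrix.diagonal (F.indicator fun _ => (1 : ℝ))

/-- The largest (real) eigenvalue of a matrix. -/
def topEigenvalue {E : Type*} [Fintype E] [DecidableEq E] (B : Matrix E E ℝ) : ℝ :=
  sSup (spectrum ℝ B)

/-- The rate `r_j(x) = λ_j / x`, where `λ_j` is the largest eigenvalue of `P - (-x) C I_j`.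
It is used at `x = -kθ` and at `x = kθ`. -/
def hopRate {E : Type*} [Fintype E] [DecidableEq E] (P : Matrix E E ℝ) (C : ℝ) (F : Set E)
    (x : ℝ) : ℝ :=
  topEigenvalue (bMatrix P C F (-x)) / x

/-- `r(-kθ) + (log ε - log (t+k-1 choose k-1)) / (θ t)`, where `r(-kθ) = min_j r_j(-kθ)`. -/
def lowerRateAt {E : Type*} [Fintype E] [DecidableEq E] {k : ℕ} (P : Matrix E E ℝ) (C : ℝ)
    (F : Fin k → Set E) (ε : ℝ) (t : ℕ) (θ : ℝ) : ℝ :=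
  (⨅ j, hopRate P C (F j) (-(k * θ))) +
    (Real.log ε - Real.log ((t + k - 1).choose (k - 1))) / (θ * t)

/-- `r(kθ) - log ε / (θ t)`, where `r(kθ) = max_j r_j(kθ)`. -/
def upperRateAt {E : Type*} [Fintype E] [DecidableEq E] {k : ℕ} (P : Matrix E E ℝ) (C : ℝ)
    (F : Fin k → Set E) (ε : ℝ) (t : ℕ) (θ : ℝ) : ℝ :=
  (⨆ j, hopRate P C (F j) (k * θ)) - Real.log ε / (θ * t)

/-- The lower bound `λ_t^L` on the capacity rate, as a supremum of extended reals. -/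
def lowerRate {E : Type*} [Fintype E] [DecidableEq E] {k : ℕ} (P : Matrix E E ℝ) (C : ℝ)
    (F : Fin k → Set E) (ε : ℝ) (t : ℕ) : EReal :=
  ⨆ θ : Set.Ioi (0 : ℝ), (lowerRateAt P C F ε t θ : EReal)

/-- The upper bound `λ_t^U` on the capacity rate, as an infimum of extended reals. -/
def upperRate {E : Type*} [Fintype E] [DecidableEq E] {k : ℕ} (P : Matrix E E ℝ) (C : ℝ)
    (F : Fin k → Set E) (ε : ℝ) (t : ℕ) : EReal :=
  ⨅ θ : Set.Ioi (0 : ℝ), (upperRateAt P C F ε t θ : EReal)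

end

/-!
Tilting the generator by a state function `f` gives the matrix `P + diag(f)`, and the Lie-Trotter
product formula turns the finite-dimensional distributions of the chain into the Feynman-Kac formula
`𝔼 exp (∫ₛᵗ f(X(u)) du) = p ⬝ᵥ exp ((t - s) (P + diag(f))) 1`. Detailed balance makes the tilted
generator self-adjoint in `L²(p)`, so the right-hand side is at most `exp ((t - s) λ)` with `λ` the
largest eigenvalue.

Along a fixed path through the hops, Hölder's inequality with `k` equal exponents removes the
dependence between the hops and is the reason for the argument `kθ` in the rates. Chernoff's bound
then controls the service along one path. `D(t)` is the minimum over all paths, hence is bounded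
from above by any single one, and from below by a union bound over the `(t+k-1 choose k-1)` paths.
-/

theorem tendsto_smul_sub_of_hasDerivAt_zero {F : Type*} [NormedAddCommGroup F] [NormedSpace ℝ F]
    {f : ℝ → F} {a : F} (hf : HasDerivAt f a 0) :
    Tendsto (fun n : ℕ => (n : ℝ) • (f (n : ℝ)⁻¹ - f 0)) atTop (𝓝 a) := by
  have hinv : Tendsto (fun n : ℕ => (n : ℝ)⁻¹) atTop (𝓝[>] 0) :=
    tendsto_inv_atTop_nhdsGT_zero.comp tendsto_natCast_atTop_atTop
  simpa [Function.comp_def] using hf.tendsto_slope_zero_right.comp hinv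

section LieTrotter

variable {𝔸 : Type*} [NormedRing 𝔸]

theorem norm_pow_succ_sub_pow_succ_le {x y : 𝔸} {R : ℝ} (hx : ‖x‖ ≤ R) (hy : ‖y‖ ≤ R) (n : ℕ) :
    ‖x ^ (n + 1) - y ^ (n + 1)‖ ≤ (n + 1) * R ^ n * ‖x - y‖ := by
  have hR : 0 ≤ R := (norm_nonneg x).trans hx
  induction n with
  | zero => simp
  | succ n ih =>
    have telescope : x ^ (n + 2) - y ^ (n + 2) =
        (x ^ (n + 1) - y ^ (n + 1)) * x + y ^ (n + 1) * (x - y) := by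
      rw [pow_succ x, pow_succ y]; noncomm_ring
    calc ‖x ^ (n + 2) - y ^ (n + 2)‖
        ≤ ‖x ^ (n + 1) - y ^ (n + 1)‖ * ‖x‖ + ‖y ^ (n + 1)‖ * ‖x - y‖ := by
          rw [telescope]
          exact norm_add_le_of_le (norm_mul_le _ _) (norm_mul_le _ _)
      _ ≤ ((n + 1) * R ^ n * ‖x - y‖) * R + R ^ (n + 1) * ‖x - y‖ := by
          gcongr
          exact (norm_pow_le' y n.succ_pos).trans (by gcongr)
      _ = ((n + 1 : ℕ) + 1) * R ^ (n + 1) * ‖x - y‖ := by push_cast; ring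

variable [NormedAlgebra ℝ 𝔸]

theorem hasDerivAt_exp_smul_zero [CompleteSpace 𝔸] (a : 𝔸) :
    HasDerivAt (fun s : ℝ => NormedSpace.exp (s • a)) a 0 := by
  simpa using hasDerivAt_exp_smul_const (𝕂 := ℝ) a (0 : ℝ)

variable [NormOneClass 𝔸]

theorem eventually_norm_le_one_add_div {x : ℕ → 𝔸} {a : 𝔸}
    (hx : Tendsto (fun n : ℕ => (n : ℝ) • (x n - 1)) atTop (𝓝 a)) :
    ∀ᶠ n : ℕ in atTop, ‖x n‖ ≤ 1 + (‖a‖ + 1) / n := by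
  filter_upwards [hx.norm.eventually_le_const (lt_add_one ‖a‖), eventually_gt_atTop 0] with n hn hn0
  rw [norm_smul, RCLike.norm_natCast] at hn
  calc ‖x n‖ = ‖1 + (x n - 1)‖ := by rw [add_sub_cancel]
    _ ≤ 1 + ‖x n - 1‖ := norm_add_le_of_le norm_one.le le_rfl
    _ ≤ 1 + (‖a‖ + 1) / n := by
        gcongr
        rwa [le_div_iff₀' (by positivity)]

theorem tendsto_pow_sub_pow_of_tendsto_smul_sub_one {x y : ℕ → 𝔸} {a : 𝔸}
    (hx : Tendsto (fun n : ℕ => (n : ℝ) • (x n - 1)) atTop (𝓝 a))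
    (hy : Tendsto (fun n : ℕ => (n : ℝ) • (y n - 1)) atTop (𝓝 a)) :
    Tendsto (fun n => x n ^ n - y n ^ n) atTop (𝓝 0) := by
  have hdiff : Tendsto
      (fun n : ℕ => Real.exp (‖a‖ + 1) * ‖(n : ℝ) • (x n - 1) - (n : ℝ) • (y n - 1)‖)
      atTop (𝓝 0) := by
    simpa using (hx.sub hy).norm.const_mul (Real.exp (‖a‖ + 1))
  refine squeeze_zero_norm' ?_ hdiff
  filter_upwards [eventually_norm_le_one_add_div hx, eventually_norm_le_one_add_div hy,
    eventually_gt_atTop 0] with n hxn hyn hn0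
  obtain ⟨m, rfl⟩ := Nat.exists_eq_succ_of_ne_zero hn0.ne'
  have hpow : (1 + (‖a‖ + 1) / (m + 1 : ℕ)) ^ m ≤ Real.exp (‖a‖ + 1) :=
    calc (1 + (‖a‖ + 1) / (m + 1 : ℕ)) ^ m
        ≤ (1 + (‖a‖ + 1) / (m + 1 : ℕ)) ^ (m + 1) :=
          pow_le_pow_right₀ (le_add_of_nonneg_right (by positivity)) m.le_succ
      _ ≤ Real.exp ((‖a‖ + 1) / (m + 1 : ℕ)) ^ (m + 1) := by
          gcongr
          rw [add_comm]
          exact Real.add_one_le_exp _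
      _ = Real.exp (‖a‖ + 1) := by
          rw [← Real.exp_nat_mul, mul_div_cancel₀ _ (by positivity)]
  calc ‖x (m + 1) ^ (m + 1) - y (m + 1) ^ (m + 1)‖
      ≤ (m + 1) * (1 + (‖a‖ + 1) / (m + 1 : ℕ)) ^ m * ‖x (m + 1) - y (m + 1)‖ :=
        norm_pow_succ_sub_pow_succ_le hxn hyn m
    _ ≤ (m + 1) * Real.exp (‖a‖ + 1) * ‖x (m + 1) - y (m + 1)‖ := by gcongr
    _ = Real.exp (‖a‖ + 1) *
          ‖((m + 1 : ℕ) : ℝ) • (x (m + 1) - 1) - ((m + 1 : ℕ) : ℝ) • (y (m + 1) - 1)‖ := by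
        rw [← smul_sub, sub_sub_sub_cancel_right, norm_smul, RCLike.norm_natCast]
        push_cast; ring

variable [CompleteSpace 𝔸]

theorem tendsto_pow_exp_of_tendsto_smul_sub_one {x : ℕ → 𝔸} {a : 𝔸}
    (hx : Tendsto (fun n : ℕ => (n : ℝ) • (x n - 1)) atTop (𝓝 a)) :
    Tendsto (fun n => x n ^ n) atTop (𝓝 (NormedSpace.exp a)) := by
  let : NormedAlgebra ℚ 𝔸 := NormedAlgebra.restrictScalars ℚ ℝ 𝔸
  have hroot : ∀ᶠ n : ℕ in atTop, NormedSpace.exp ((n : ℝ)⁻¹ • a) ^ n = NormedSpace.exp a := by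
    filter_upwards [eventually_ne_atTop 0] with n hn
    rw [← NormedSpace.exp_nsmul, ← Nat.cast_smul_eq_nsmul ℝ, smul_inv_smul₀ (Nat.cast_ne_zero.2 hn)]
  have hsub := (tendsto_pow_sub_pow_of_tendsto_smul_sub_one hx
    (by simpa using tendsto_smul_sub_of_hasDerivAt_zero (hasDerivAt_exp_smul_zero a))).add_const
      (NormedSpace.exp a)
  rw [zero_add] at hsub
  refine hsub.congr' (hroot.mono fun n hn => ?_)
  rw [hn, sub_add_cancel]

theorem tendsto_exp_mul_exp_pow (a b : 𝔸) :
    Tendsto (fun n : ℕ => (NormedSpace.exp ((n : ℝ)⁻¹ • a) * NormedSpace.exp ((n : ℝ)⁻¹ • b)) ^ n)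
      atTop (𝓝 (NormedSpace.exp (a + b))) := by
  refine tendsto_pow_exp_of_tendsto_smul_sub_one ?_
  simpa [add_comm] using tendsto_smul_sub_of_hasDerivAt_zero
    ((hasDerivAt_exp_smul_zero a).fun_mul (hasDerivAt_exp_smul_zero b))

end LieTrotter

section MatrixSemigroup

open Matrix

variable {E : Type*} [Fintype E] [DecidableEq E]

theorem matrix_tendsto_exp_mul_exp_pow (A B : Matrix E E ℝ) :
    Tendsto (fun n : ℕ => (NormedSpace.exp ((n : ℝ)⁻¹ • A) * NormedSpace.exp ((n : ℝ)⁻¹ • B)) ^ n)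
      atTop (𝓝 (NormedSpace.exp (A + B))) := by
  let : NormedRing (Matrix E E ℝ) := Matrix.linftyOpNormedRing
  let : NormedAlgebra ℝ (Matrix E E ℝ) := Matrix.linftyOpNormedAlgebra
  cases isEmpty_or_nonempty E
  · exact tendsto_const_nhds.congr fun n => Subsingleton.elim _ _
  · have : NormOneClass (Matrix E E ℝ) := Matrix.linfty_opNormOneClass
    exact tendsto_exp_mul_exp_pow A B

theorem matrix_exp_smul_diagonal (t : ℝ) (v : E → ℝ) :
    NormedSpace.exp (t • diagonal v) = diagonal fun i => Real.exp (t * v i) := by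
  rw [← diagonal_smul, Matrix.exp_diagonal]
  congr 1
  ext i
  rw [Pi.coe_exp, Real.exp_eq_exp_ℝ]
  rfl

theorem semiconjBy_exp_smul {A B D : Matrix E E ℝ} (h : SemiconjBy D A B) (t : ℝ) :
    SemiconjBy D (NormedSpace.exp (t • A)) (NormedSpace.exp (t • B)) := by
  let : NormedRing (Matrix E E ℝ) := Matrix.linftyOpNormedRing
  let : NormedAlgebra ℝ (Matrix E E ℝ) := Matrix.linftyOpNormedAlgebra
  let : NormedAlgebra ℚ (Matrix E E ℝ) := NormedAlgebra.restrictScalars ℚ ℝ _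
  refine SemiconjBy.exp_right ?_
  rw [SemiconjBy, mul_smul_comm, smul_mul_assoc, h.eq]

theorem exp_smul_eq_eigenvectorUnitary_mul {S : Matrix E E ℝ} (hS : S.IsHermitian) (t : ℝ) :
    NormedSpace.exp (t • S) = (hS.eigenvectorUnitary : Matrix E E ℝ) *
      diagonal (fun j => Real.exp (t * hS.eigenvalues j)) *
      (hS.eigenvectorUnitary : Matrix E E ℝ)ᵀ := by
  set U : Matrix E E ℝ := (hS.eigenvectorUnitary : Matrix E E ℝ)
  have hU : U * Uᵀ = 1 := Unitary.mul_star_self_of_mem hS.eigenvectorUnitary.2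
  have hinv : U⁻¹ = Uᵀ := Matrix.inv_eq_right_inv hU
  have hspec : t • S = U * (t • diagonal hS.eigenvalues) * U⁻¹ := by
    conv_lhs => rw [hS.spectral_theorem]
    rw [hinv, mul_smul_comm, smul_mul_assoc]; rfl
  rw [hspec, Matrix.exp_conj _ _ (IsUnit.of_mul_eq_one _ hU), hinv, matrix_exp_smul_diagonal]

theorem dotProduct_exp_smul_mulVec {S : Matrix E E ℝ} (hS : S.IsHermitian) (t : ℝ) (w : E → ℝ) :
    w ⬝ᵥ (NormedSpace.exp (t • S) *ᵥ w) =
      ∑ j, Real.exp (t * hS.eigenvalues j) * (w ⬝ᵥ ⇑(hS.eigenvectorBasis j)) ^ 2 := by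
  have hcoord : ∀ j, (w ᵥ* (hS.eigenvectorUnitary : Matrix E E ℝ)) j =
      w ⬝ᵥ ⇑(hS.eigenvectorBasis j) := fun j => by
    simp only [vecMul, dotProduct, Matrix.IsHermitian.eigenvectorUnitary_apply]
  rw [exp_smul_eq_eigenvectorUnitary_mul hS, ← mulVec_mulVec, ← mulVec_mulVec, dotProduct_mulVec,
    mulVec_transpose]
  simp only [dotProduct, mulVec_diagonal, hcoord]
  exact Finset.sum_congr rfl fun j _ => by ring

theorem le_topEigenvalue {B : Matrix E E ℝ} {a : ℝ} (h : a ∈ spectrum ℝ B) :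
    a ≤ topEigenvalue B :=
  le_csSup B.finite_real_spectrum.bddAbove h

theorem mem_spectrum_of_mulVec_eq_smul {B : Matrix E E ℝ} {a : ℝ} {v : E → ℝ} (hv : v ≠ 0)
    (h : B *ᵥ v = a • v) : a ∈ spectrum ℝ B := by
  rw [← Matrix.spectrum_toLin']
  refine Module.End.HasEigenvalue.mem_spectrum
    (Module.End.hasEigenvalue_of_hasEigenvector (x := v) ⟨?_, hv⟩)
  rw [Module.End.mem_eigenspace_iff, toLin'_apply, h]

theorem mem_spectrum_of_vecMul_eq_smul {B : Matrix E E ℝ} {a : ℝ} {v : E → ℝ} (hv : v ≠ 0)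
    (h : v ᵥ* B = a • v) : a ∈ spectrum ℝ B := by
  rw [Matrix.mem_spectrum_iff_isRoot_charpoly, ← Matrix.charpoly_transpose,
    ← Matrix.mem_spectrum_iff_isRoot_charpoly]
  exact mem_spectrum_of_mulVec_eq_smul hv (by rw [mulVec_transpose, h])

/-- The symmetrization `diag(√p) B diag(√p)⁻¹` of a matrix `B` in detailed balance with `p`.
The junk value `0⁻¹ = 0` makes the columns off the support of `p` vanish. -/
noncomputable def symmetrization (p : E → ℝ) (B : Matrix E E ℝ) : Matrix E E ℝ :=
  diagonal (fun i => √(p i)) * B * diagonal fun i => (√(p i))⁻¹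

section DetailedBalance

variable {p : E → ℝ} {B : Matrix E E ℝ}

theorem semiconjBy_symmetrization (hp : ∀ i, 0 ≤ p i) (hB : ∀ i l, p i * B i l = p l * B l i) :
    SemiconjBy (diagonal fun i => √(p i)) B (symmetrization p B) := by
  ext i l
  rw [symmetrization, mul_assoc, diagonal_mul_diagonal, mul_diagonal, diagonal_mul]
  by_cases hl : p l = 0
  · have hrow : p i = 0 ∨ B i l = 0 := by
      rw [← mul_eq_zero, hB, hl, zero_mul]
    have hcol : √(p i) * B i l = 0 := by rwa [mul_eq_zero, Real.sqrt_eq_zero (hp i)]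
    rw [hcol, hl, Real.sqrt_zero, mul_zero, mul_zero]
  · rw [inv_mul_cancel₀ ((Real.sqrt_ne_zero (hp l)).2 hl), mul_one]

theorem isHermitian_symmetrization (hp : ∀ i, 0 ≤ p i) (hB : ∀ i l, p i * B i l = p l * B l i) :
    (symmetrization p B).IsHermitian := by
  have hdiv : ∀ i l, symmetrization p B i l = (p i * B i l) * ((√(p i))⁻¹ * (√(p l))⁻¹) := by
    intro i l
    rw [symmetrization, mul_diagonal, diagonal_mul]
    by_cases hi : p i = 0
    · simp [hi]
    · have h := (Real.sqrt_ne_zero (hp i)).2 hi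
      nth_rw 2 [← Real.mul_self_sqrt (hp i)]
      field_simp
  ext i l
  rw [conjTranspose_apply, star_trivial, hdiv, hdiv, hB, mul_comm (√(p l))⁻¹]

theorem eigenvalues_symmetrization_le_topEigenvalue (hp : ∀ i, 0 ≤ p i)
    (hB : ∀ i l, p i * B i l = p l * B l i) {j : E}
    (hj : (fun i => √(p i)) ⬝ᵥ ⇑((isHermitian_symmetrization hp hB).eigenvectorBasis j) ≠ 0) :
    (isHermitian_symmetrization hp hB).eigenvalues j ≤ topEigenvalue B := by
  set hS := isHermitian_symmetrization hp hB
  set v : E → ℝ := ⇑(hS.eigenvectorBasis j)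
  have heig : v ᵥ* symmetrization p B = hS.eigenvalues j • v := by
    rw [← mulVec_transpose, ← conjTranspose_eq_transpose_of_trivial, hS.eq]
    exact hS.mulVec_eigenvectorBasis j
  refine le_topEigenvalue (mem_spectrum_of_vecMul_eq_smul
    (v := v ᵥ* diagonal fun i => √(p i)) (fun h => hj ?_) ?_)
  · calc (fun i => √(p i)) ⬝ᵥ v = (v ᵥ* diagonal fun i => √(p i)) ⬝ᵥ 1 := by
          simp only [dotProduct, vecMul_diagonal, Pi.one_apply, mul_one, mul_comm (v _)]
      _ = 0 := by rw [h, zero_dotProduct]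
  · rw [vecMul_vecMul, (semiconjBy_symmetrization hp hB).eq, ← vecMul_vecMul, heig, smul_vecMul]

theorem dotProduct_exp_smul_mulVec_one_eq (hp : ∀ i, 0 ≤ p i)
    (hB : ∀ i l, p i * B i l = p l * B l i) (t : ℝ) :
    p ⬝ᵥ (NormedSpace.exp (t • B) *ᵥ 1) = (fun i => √(p i)) ⬝ᵥ
      (NormedSpace.exp (t • symmetrization p B) *ᵥ fun i => √(p i)) := by
  set w : E → ℝ := fun i => √(p i)
  have hpw : p = w ᵥ* diagonal w := by
    ext i
    rw [vecMul_diagonal, Real.mul_self_sqrt (hp i)]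
  have hw : diagonal w *ᵥ 1 = w := by
    ext i
    rw [mulVec_diagonal, Pi.one_apply, mul_one]
  conv_lhs => rw [hpw]
  rw [← dotProduct_mulVec, mulVec_mulVec,
    (semiconjBy_exp_smul (semiconjBy_symmetrization hp hB) t).eq, ← mulVec_mulVec, hw]

theorem dotProduct_exp_smul_mulVec_one_le (hp : ∀ i, 0 ≤ p i)
    (hB : ∀ i l, p i * B i l = p l * B l i) {t : ℝ} (ht : 0 ≤ t) :
    p ⬝ᵥ (NormedSpace.exp (t • B) *ᵥ 1) ≤ Real.exp (t * topEigenvalue B) * ∑ i, p i := by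
  set hS := isHermitian_symmetrization hp hB
  set w : E → ℝ := fun i => √(p i)
  have parseval : ∑ j, (w ⬝ᵥ ⇑(hS.eigenvectorBasis j)) ^ 2 = ∑ i, p i :=
    calc ∑ j, (w ⬝ᵥ ⇑(hS.eigenvectorBasis j)) ^ 2 = w ⬝ᵥ w := by
          simpa using (dotProduct_exp_smul_mulVec hS 0 w).symm
      _ = ∑ i, p i := Finset.sum_congr rfl fun i _ => Real.mul_self_sqrt (hp i)
  rw [dotProduct_exp_smul_mulVec_one_eq hp hB, dotProduct_exp_smul_mulVec hS, ← parseval,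
    Finset.mul_sum]
  refine Finset.sum_le_sum fun j _ => ?_
  by_cases hj : w ⬝ᵥ ⇑(hS.eigenvectorBasis j) = 0
  · rw [hj, zero_pow two_ne_zero, mul_zero, mul_zero]
  · gcongr
    exact eigenvalues_symmetrization_le_topEigenvalue hp hB hj

end DetailedBalance

end MatrixSemigroup

section RiemannSums

theorem tendsto_nat_ceil_mul_div_nhdsGE {x : ℝ} (hx : 0 ≤ x) :
    Tendsto (fun n : ℕ => (⌈x * n⌉₊ : ℝ) / n) atTop (𝓝[≥] x) := by
  refine tendsto_nhdsWithin_iff.2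
    ⟨(tendsto_nat_ceil_mul_div_atTop hx).comp tendsto_natCast_atTop_atTop, ?_⟩
  filter_upwards [eventually_gt_atTop 0] with n hn
  rw [Set.mem_Ici, le_div_iff₀ (Nat.cast_pos.2 hn)]
  exact Nat.le_ceil _

theorem stronglyMeasurable_comp_nat_ceil_mul_div {F : Type*} [TopologicalSpace F] (g : ℝ → F)
    (n : ℕ) :
    StronglyMeasurable fun x : ℝ => g ((⌈x * n⌉₊ : ℝ) / n) :=
  (StronglyMeasurable.of_discrete (f := fun m : ℕ => g ((m : ℝ) / n))).comp_measurable
    (Nat.measurable_ceil.comp (measurable_id.mul_const _))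

variable {F : Type*} [NormedAddCommGroup F] [NormedSpace ℝ F] {g : ℝ → F} {K : ℝ}

theorem integral_comp_nat_ceil_mul_div [CompleteSpace F] (hK : ∀ x, ‖g x‖ ≤ K) {n : ℕ}
    (hn : 0 < n) :
    ∫ x in (0 : ℝ)..1, g ((⌈x * n⌉₊ : ℝ) / n) =
      (n : ℝ)⁻¹ • ∑ m ∈ Finset.range n, g (((m + 1 : ℕ) : ℝ) / n) := by
  have hn0 : (0 : ℝ) < n := Nat.cast_pos.2 hn
  have hint (a b : ℝ) : IntervalIntegrable (fun x => g ((⌈x * n⌉₊ : ℝ) / n)) volume a b :=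
    (intervalIntegrable_const (c := K)).mono_fun
      (stronglyMeasurable_comp_nat_ceil_mul_div g n).aestronglyMeasurable
      (ae_of_all _ fun x => (hK _).trans (le_abs_self K))
  have hcell (m : ℕ) : ∫ x in ((m : ℝ) / n)..(((m + 1 : ℕ) : ℝ) / n), g ((⌈x * n⌉₊ : ℝ) / n) =
      (n : ℝ)⁻¹ • g (((m + 1 : ℕ) : ℝ) / n) := by
    have hlen : ((m + 1 : ℕ) : ℝ) / n - (m : ℝ) / n = (n : ℝ)⁻¹ := by
      push_cast; ring
    have hle : (m : ℝ) / n ≤ ((m + 1 : ℕ) : ℝ) / n := by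
      gcongr; exact m.le_succ
    rw [intervalIntegral.integral_congr_Ioo_of_le (g := fun _ => g (((m + 1 : ℕ) : ℝ) / n)) hle
      fun x hx => ?_, intervalIntegral.integral_const, hlen]
    have hceil : ⌈x * n⌉₊ = m + 1 := by
      rw [Nat.ceil_eq_iff (Nat.add_one_ne_zero m), Nat.add_sub_cancel]
      exact ⟨(div_lt_iff₀ hn0).1 hx.1, (le_div_iff₀ hn0).1 hx.2.le⟩
    simp only [hceil]
  have hsum := intervalIntegral.sum_integral_adjacent_intervals (μ := volume)
    (a := fun m : ℕ => (m : ℝ) / n) (n := n) fun m _ => hint _ _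
  rw [Nat.cast_zero, zero_div, div_self hn0.ne'] at hsum
  rw [← hsum, Finset.smul_sum]
  exact Finset.sum_congr rfl fun m _ => hcell m

theorem tendsto_riemannSum_unit [CompleteSpace F] (hK : ∀ x, ‖g x‖ ≤ K)
    (hg : ∀ x, ContinuousWithinAt g (Set.Ici x) x) :
    Tendsto (fun n : ℕ => (n : ℝ)⁻¹ • ∑ m ∈ Finset.range n, g (((m + 1 : ℕ) : ℝ) / n)) atTop
      (𝓝 (∫ x in (0 : ℝ)..1, g x)) := by
  have hlim : Tendsto (fun n : ℕ => ∫ x in (0 : ℝ)..1, g ((⌈x * n⌉₊ : ℝ) / n)) atTop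
      (𝓝 (∫ x in (0 : ℝ)..1, g x)) := by
    refine intervalIntegral.tendsto_integral_filter_of_dominated_convergence (fun _ => K)
      (.of_forall fun n => (stronglyMeasurable_comp_nat_ceil_mul_div g n).aestronglyMeasurable)
      (.of_forall fun n => ae_of_all _ fun x _ => hK _) intervalIntegrable_const
      (ae_of_all _ fun x hx => ?_)
    rw [Set.uIoc_of_le zero_le_one] at hx
    exact (hg x).tendsto.comp (tendsto_nat_ceil_mul_div_nhdsGE hx.1.le)
  refine hlim.congr' ?_
  filter_upwards [eventually_gt_atTop 0] with n hn using integral_comp_nat_ceil_mul_div hK hn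

/-- The Riemann sum of `g` over `[a, b]` with `n` cells of equal length and right end points as
tags, which is the choice that suits right-continuous integrands. -/
noncomputable def riemannSum (g : ℝ → F) (a b : ℝ) (n : ℕ) : F :=
  ((b - a) / n) • ∑ m ∈ Finset.range n, g (a + (m + 1 : ℕ) * ((b - a) / n))

theorem norm_riemannSum_le (hK : ∀ x, ‖g x‖ ≤ K) {a b : ℝ} (hab : a ≤ b) {n : ℕ} (hn : 0 < n) :
    ‖riemannSum g a b n‖ ≤ (b - a) * K := by
  have hδ : 0 ≤ (b - a) / n := div_nonneg (sub_nonneg.2 hab) n.cast_nonneg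
  calc ‖riemannSum g a b n‖ ≤ (b - a) / n * (n * K) := by
        rw [riemannSum, norm_smul, Real.norm_of_nonneg hδ]
        gcongr
        simpa using norm_sum_le_of_le (Finset.range n) fun m _ =>
          hK (a + (m + 1 : ℕ) * ((b - a) / n))
    _ = (b - a) * K := by
        rw [← mul_assoc, div_mul_cancel₀ _ (Nat.cast_ne_zero.2 hn.ne')]

theorem tendsto_riemannSum [CompleteSpace F] (hK : ∀ x, ‖g x‖ ≤ K)
    (hg : ∀ x, ContinuousWithinAt g (Set.Ici x) x) {a b : ℝ} (hab : a ≤ b) :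
    Tendsto (riemannSum g a b) atTop (𝓝 (∫ x in a..b, g x)) := by
  have haffine (x : ℝ) :
      ContinuousWithinAt (fun x => g (a + (b - a) * x)) (Set.Ici x) x := by
    have hmaps : Set.MapsTo (fun x => a + (b - a) * x) (Set.Ici x) (Set.Ici (a + (b - a) * x)) :=
      fun y hy => add_le_add_right (mul_le_mul_of_nonneg_left hy (sub_nonneg.2 hab)) a
    exact (hg (a + (b - a) * x)).comp (f := fun x => a + (b - a) * x) (by fun_prop) hmaps
  have hlim := (tendsto_riemannSum_unit (fun x => hK (a + (b - a) * x)) haffine).const_smul (b - a)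
  rw [intervalIntegral.smul_integral_comp_add_mul, mul_zero, add_zero, mul_one,
    add_sub_cancel] at hlim
  refine hlim.congr fun n => ?_
  rw [riemannSum, smul_smul, ← div_eq_mul_inv]
  simp only [mul_div_left_comm (b - a)]

end RiemannSums

section FeynmanKac

open Matrix

theorem sum_prod_transitions {E : Type*} [Fintype E] [DecidableEq E] (M : Matrix E E ℝ)
    (f : E → ℝ) (N : ℕ) :
    ∑ i : Fin (N + 1) → E, f (i 0) * ∏ m : Fin N, M (i m.castSucc) (i m.succ) =
      f ⬝ᵥ (M ^ N *ᵥ 1) := by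
  induction N generalizing f with
  | zero =>
    rw [← (Equiv.funUnique (Fin 1) E).symm.sum_comp]
    simp [dotProduct]
  | succ N ih =>
    rw [pow_succ', ← mulVec_mulVec, dotProduct_mulVec, ← ih,
      ← (Fin.consEquiv fun _ => E).sum_comp, Fintype.sum_prod_type, Finset.sum_comm]
    refine Finset.sum_congr rfl fun i _ => ?_
    rw [vecMul, dotProduct, Finset.sum_mul]
    refine Finset.sum_congr rfl fun a _ => ?_
    rw [Fin.prod_univ_succ]
    simp [Fin.consEquiv, mul_assoc]

/-- The additive functional `∫ₛᵗ f(X(u)) du` of a process `X`. -/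
noncomputable def additiveFunctional {Ω E : Type*} (X : ℝ≥0 → Ω → E) (f : E → ℝ) (ω : Ω)
    (s t : ℝ) : ℝ :=
  ∫ u in s..t, f (X u.toNNReal ω)

theorem abs_additiveFunctional_le {Ω E : Type*} [Fintype E] (X : ℝ≥0 → Ω → E) (f : E → ℝ) (ω : Ω)
    (s t : ℝ) : |additiveFunctional X f ω s t| ≤ ‖f‖ * |t - s| :=
  intervalIntegral.norm_integral_le_of_norm_le_const fun _ _ => norm_le_pi_norm f _

theorem additiveFunctional_smul {Ω E : Type*} (X : ℝ≥0 → Ω → E) (f : E → ℝ) (y : ℝ) (ω : Ω)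
    (s t : ℝ) : additiveFunctional X (y • f) ω s t = y * additiveFunctional X f ω s t :=
  intervalIntegral.integral_const_mul y _

variable {Ω E : Type*} [MeasurableSpace Ω] [Fintype E] [DecidableEq E] {μ : Measure Ω}
  {P : Matrix E E ℝ} {p : E → ℝ} {X : ℝ≥0 → Ω → E}

theorem IsMarkovChain.measurable (hX : IsMarkovChain μ P p X) (t : ℝ≥0) :
    Measurable[_, ⊤] (X t) :=
  letI : MeasurableSpace E := ⊤
  measurable_to_countable' fun i => hX.measurable_fiber t i

theorem IsMarkovChain.integral_prod_comp [IsFiniteMeasure μ] (hX : IsMarkovChain μ P p X)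
    (g : E → ℝ) {s δ : ℝ} (hs : 0 ≤ s) (hδ : 0 ≤ δ) (N : ℕ) :
    ∫ ω, ∏ m ∈ Finset.range N, g (X (s + (m + 1 : ℕ) * δ).toNNReal ω) ∂μ =
      p ⬝ᵥ ((NormedSpace.exp (δ • P) * diagonal g) ^ N *ᵥ 1) := by
  let _ : MeasurableSpace E := ⊤
  let τ : Fin (N + 1) → ℝ≥0 := fun m => (s + m * δ).toNNReal
  have hτ : Monotone τ := fun m n hmn => Real.toNNReal_mono <| by
    gcongr
    exact hmn
  have hstep (m : Fin N) : (τ m.succ : ℝ) - τ m.castSucc = δ := by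
    simp only [τ]
    rw [Real.coe_toNNReal _ (by positivity), Real.coe_toNNReal _ (by positivity)]
    push_cast [Fin.val_succ, Fin.val_castSucc]
    ring
  let Y : Ω → Fin (N + 1) → E := fun ω m => X (τ m) ω
  have hY : Measurable Y := measurable_pi_iff.2 fun m => hX.measurable _
  have hlaw (i : Fin (N + 1) → E) : (μ.map Y).real {i} =
      p (i 0) * ∏ m : Fin N, NormedSpace.exp (δ • P) (i m.castSucc) (i m.succ) := by
    have hset : Y ⁻¹' {i} = {ω | ∀ m, X (τ m) ω = i m} := Set.ext fun ω => funext_iff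
    rw [map_measureReal_apply hY (measurableSet_singleton i), hset, hX.finite_dim N τ i hτ]
    simp only [hstep]
  calc ∫ ω, ∏ m ∈ Finset.range N, g (X (s + (m + 1 : ℕ) * δ).toNNReal ω) ∂μ
      = ∫ ω, ∏ m : Fin N, g (Y ω m.succ) ∂μ := by
        simp only [Finset.prod_range, Y, τ, Fin.val_succ]
    _ = ∫ i, ∏ m : Fin N, g (i m.succ) ∂(μ.map Y) :=
        (integral_map (f := fun i => ∏ m : Fin N, g (i m.succ)) hY.aemeasurable
          (measurable_of_countable _).aestronglyMeasurable).symm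
    _ = ∑ i, (μ.map Y).real {i} • ∏ m : Fin N, g (i m.succ) := integral_fintype .of_finite
    _ = ∑ i : Fin (N + 1) → E, p (i 0) * ∏ m : Fin N,
          (NormedSpace.exp (δ • P) * diagonal g) (i m.castSucc) (i m.succ) := by
        simp only [hlaw, mul_diagonal, Finset.prod_mul_distrib, smul_eq_mul, mul_assoc]
    _ = p ⬝ᵥ ((NormedSpace.exp (δ • P) * diagonal g) ^ N *ᵥ 1) := sum_prod_transitions _ p N

theorem IsMarkovChain.continuousWithinAt_comp (hX : IsMarkovChain μ P p X) (f : E → ℝ) (ω : Ω)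
    (u : ℝ) : ContinuousWithinAt (fun u : ℝ => f (X u.toNNReal ω)) (Set.Ici u) u := by
  have hconst : ∀ᶠ v in 𝓝[≥] u.toNNReal, X v ω = X u.toNNReal ω := by
    rw [← Set.Ioi_insert, nhdsWithin_insert, eventually_sup]
    exact ⟨rfl, hX.right_continuous ω _⟩
  have htoNNReal : Tendsto Real.toNNReal (𝓝[≥] u) (𝓝[≥] u.toNNReal) :=
    continuous_real_toNNReal.continuousWithinAt.tendsto_nhdsWithin fun _ hv =>
      Real.toNNReal_mono hv
  exact tendsto_const_nhds.congr'
    ((htoNNReal.eventually hconst).mono fun v hv => congrArg f hv.symm)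

theorem IsMarkovChain.tendsto_riemannSum (hX : IsMarkovChain μ P p X) (f : E → ℝ) (ω : Ω)
    {s t : ℝ} (hst : s ≤ t) :
    Tendsto (riemannSum (fun u => f (X u.toNNReal ω)) s t) atTop
      (𝓝 (additiveFunctional X f ω s t)) :=
  _root_.tendsto_riemannSum (fun _ => norm_le_pi_norm f _) (hX.continuousWithinAt_comp f ω) hst

theorem IsMarkovChain.measurable_riemannSum (hX : IsMarkovChain μ P p X) (f : E → ℝ) (s t : ℝ)
    (n : ℕ) : Measurable fun ω => riemannSum (fun u => f (X u.toNNReal ω)) s t n :=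
  .const_mul (Finset.measurable_fun_sum _ fun _ _ =>
    (measurable_from_top (f := f)).comp (hX.measurable _)) _

theorem IsMarkovChain.measurable_additiveFunctional (hX : IsMarkovChain μ P p X) (f : E → ℝ)
    {s t : ℝ} (hst : s ≤ t) : Measurable fun ω => additiveFunctional X f ω s t :=
  measurable_of_tendsto_metrizable (hX.measurable_riemannSum f s t)
    (tendsto_pi_nhds.2 fun ω => hX.tendsto_riemannSum f ω hst)

theorem IsMarkovChain.integral_exp_riemannSum [IsFiniteMeasure μ] (hX : IsMarkovChain μ P p X)
    (f : E → ℝ) {s t : ℝ} (hs : 0 ≤ s) (hst : s ≤ t) (n : ℕ) :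
    ∫ ω, Real.exp (riemannSum (fun u => f (X u.toNNReal ω)) s t n) ∂μ =
      p ⬝ᵥ ((NormedSpace.exp ((n : ℝ)⁻¹ • (t - s) • P) *
        NormedSpace.exp ((n : ℝ)⁻¹ • (t - s) • diagonal f)) ^ n *ᵥ 1) := by
  have hδ : 0 ≤ (t - s) / n := div_nonneg (sub_nonneg.2 hst) n.cast_nonneg
  simp only [smul_smul, inv_mul_eq_div, matrix_exp_smul_diagonal]
  rw [← hX.integral_prod_comp _ hs hδ]
  simp only [riemannSum, smul_eq_mul, Finset.mul_sum, Real.exp_sum]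

theorem IsMarkovChain.integral_exp_additiveFunctional [IsFiniteMeasure μ]
    (hX : IsMarkovChain μ P p X) (f : E → ℝ) {s t : ℝ} (hs : 0 ≤ s) (hst : s ≤ t) :
    ∫ ω, Real.exp (additiveFunctional X f ω s t) ∂μ =
      p ⬝ᵥ (NormedSpace.exp ((t - s) • (P + diagonal f)) *ᵥ 1) := by
  have hintegral : Tendsto
      (fun n : ℕ => ∫ ω, Real.exp (riemannSum (fun u => f (X u.toNNReal ω)) s t n) ∂μ) atTop
      (𝓝 (∫ ω, Real.exp (additiveFunctional X f ω s t) ∂μ)) := by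
    refine tendsto_integral_filter_of_dominated_convergence
      (fun _ => Real.exp ((t - s) * ‖f‖))
      (.of_forall fun n => (hX.measurable_riemannSum f s t n).exp.aestronglyMeasurable) ?_
      (integrable_const _)
      (ae_of_all _ fun ω => (hX.tendsto_riemannSum f ω hst).rexp)
    filter_upwards [eventually_gt_atTop 0] with n hn
    refine ae_of_all _ fun ω => ?_
    rw [Real.norm_of_nonneg (Real.exp_pos _).le]
    exact Real.exp_le_exp.2 ((le_abs_self _).trans
      (norm_riemannSum_le (fun _ => norm_le_pi_norm f _) hst hn))
  have hpair : Continuous fun M : Matrix E E ℝ => p ⬝ᵥ (M *ᵥ 1) := by fun_prop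
  have htrotter := (hpair.tendsto _).comp
    (matrix_tendsto_exp_mul_exp_pow ((t - s) • P) ((t - s) • diagonal f))
  rw [smul_add]
  refine tendsto_nhds_unique hintegral (htrotter.congr fun n => ?_)
  exact (hX.integral_exp_riemannSum f hs hst n).symm

theorem IsMarkovChain.integrable_exp_additiveFunctional [IsFiniteMeasure μ]
    (hX : IsMarkovChain μ P p X) (f : E → ℝ) {s t : ℝ} (hst : s ≤ t) :
    Integrable (fun ω => Real.exp (additiveFunctional X f ω s t)) μ := by
  refine .of_bound (hX.measurable_additiveFunctional f hst).exp.aestronglyMeasurable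
    (Real.exp (‖f‖ * |t - s|)) (ae_of_all _ fun ω => ?_)
  rw [Real.norm_of_nonneg (Real.exp_pos _).le]
  exact Real.exp_le_exp.2 ((le_abs_self _).trans (abs_additiveFunctional_le X f ω s t))

theorem IsReversibleDistribution.add_diagonal (hp : IsReversibleDistribution P p) (f : E → ℝ) :
    IsReversibleDistribution (P + diagonal f) p where
  nonneg := hp.nonneg
  sum_eq_one := hp.sum_eq_one
  detailed_balance i l := by
    rcases eq_or_ne i l with rfl | h
    · rfl
    · simpa [h, h.symm] using hp.detailed_balance i l

theorem IsMarkovChain.integral_exp_additiveFunctional_le [IsFiniteMeasure μ]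
    (hX : IsMarkovChain μ P p X) (hp : IsReversibleDistribution P p) (f : E → ℝ) {s t : ℝ}
    (hs : 0 ≤ s) (hst : s ≤ t) :
    ∫ ω, Real.exp (additiveFunctional X f ω s t) ∂μ ≤
      Real.exp ((t - s) * topEigenvalue (P + diagonal f)) := by
  have hq := hp.add_diagonal f
  calc ∫ ω, Real.exp (additiveFunctional X f ω s t) ∂μ
      = p ⬝ᵥ (NormedSpace.exp ((t - s) • (P + diagonal f)) *ᵥ 1) :=
        hX.integral_exp_additiveFunctional f hs hst
    _ ≤ Real.exp ((t - s) * topEigenvalue (P + diagonal f)) * ∑ i, p i :=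
        dotProduct_exp_smul_mulVec_one_le hq.nonneg hq.detailed_balance (sub_nonneg.2 hst)
    _ = Real.exp ((t - s) * topEigenvalue (P + diagonal f)) := by rw [hp.sum_eq_one, mul_one]

end FeynmanKac

section MinPlus

/-- The service received in all `k` hops along the path that stays `d j` slots in hop `j`, that is,
`∑ⱼ S_j(u_{j-1}, u_j)` with `u_j = d 0 + ⋯ + d j`. -/
def pathService {k : ℕ} (S : Fin k → ℕ → ℕ → ℝ) (d : Fin k → ℕ) : ℝ :=
  ∑ j, S j (Fin.partialSum d j.castSucc) (Fin.partialSum d j.succ)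

theorem partialSum_castSucc_le_succ {k : ℕ} (d : Fin k → ℕ) (j : Fin k) :
    Fin.partialSum d j.castSucc ≤ Fin.partialSum d j.succ := by
  rw [Fin.partialSum_succ]
  exact Nat.le_add_right _ _

theorem partialSum_snoc_castSucc {k : ℕ} (d : Fin k → ℕ) (a : ℕ) (j : Fin (k + 1)) :
    Fin.partialSum (Fin.snoc d a : Fin (k + 1) → ℕ) j.castSucc = Fin.partialSum d j := by
  rw [← Fin.partialSum_init, Fin.init_snoc]

theorem partialSum_last {k : ℕ} (d : Fin k → ℕ) : Fin.partialSum d (Fin.last k) = ∑ j, d j := by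
  rw [Fin.partialSum, Fin.val_last, List.take_of_length_le (by simp), List.sum_ofFn]

theorem mul_pathService {k : ℕ} (hk : k ≠ 0) (S : Fin k → ℕ → ℕ → ℝ) (d : Fin k → ℕ) (y : ℝ) :
    y * pathService S d =
      ∑ j, (k : ℝ)⁻¹ * (k * y * S j (Fin.partialSum d j.castSucc) (Fin.partialSum d j.succ)) := by
  rw [pathService, Finset.mul_sum]
  exact Finset.sum_congr rfl fun j _ => by field_simp

theorem pathService_snoc {k : ℕ} (S : Fin (k + 1) → ℕ → ℕ → ℝ) (d : Fin k → ℕ) (a : ℕ) :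
    pathService S (Fin.snoc d a : Fin (k + 1) → ℕ) =
      pathService (fun j => S j.castSucc) d + S (Fin.last k) (∑ j, d j) ((∑ j, d j) + a) := by
  simp only [pathService, Fin.sum_univ_castSucc (n := k), Fin.partialSum_succ,
    partialSum_snoc_castSucc, partialSum_last, Fin.snoc_last, Fin.snoc_castSucc]

theorem minPlusConv_le_coe_iff {A : ℕ → EReal} {S : ℕ → ℕ → ℝ} {t : ℕ} {x : ℝ} :
    minPlusConv A S t ≤ x ↔ ∃ s ≤ t, A s ≤ ((x - S s t : ℝ) : EReal) := by
  rw [minPlusConv, Finset.inf_le_iff (EReal.coe_lt_top x)]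
  simp only [Finset.mem_range, Nat.lt_succ_iff, EReal.coe_sub]
  refine exists_congr fun s => and_congr_right fun _ => ?_
  rw [EReal.le_sub_iff_add_le (by simp) (by simp)]

theorem departures_saturated_le_coe_iff {k : ℕ} {S : Fin k → ℕ → ℕ → ℝ} {t : ℕ} {x : ℝ} :
    departures saturatedArrivals k S t ≤ x ↔
      ∃ d : Fin k → ℕ, ∑ j, d j = t ∧ pathService S d ≤ x := by
  induction k generalizing t x with
  | zero =>
    by_cases h : t = 0 <;> simp [departures, saturatedArrivals, pathService, h, eq_comm]
  | succ k ih =>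
    simp only [departures, minPlusConv_le_coe_iff, ih]
    constructor
    · rintro ⟨_, hst, d, rfl, hd⟩
      obtain ⟨a, rfl⟩ := Nat.exists_eq_add_of_le hst
      refine ⟨Fin.snoc d a, by simp [Fin.sum_univ_castSucc], ?_⟩
      rw [pathService_snoc]
      exact le_sub_iff_add_le.1 hd
    · rintro ⟨d, rfl, hd⟩
      rw [← Fin.snoc_init_self d, pathService_snoc] at hd
      rw [Fin.sum_univ_castSucc]
      exact ⟨∑ j : Fin k, d j.castSucc, Nat.le_add_right _ _, Fin.init d, rfl,
        le_sub_iff_add_le.2 hd⟩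

theorem card_piAntidiag_univ_nat (k t : ℕ) :
    (Finset.piAntidiag (Finset.univ : Finset (Fin k)) t).card = k.multichoose t := by
  have h := Finset.card_finsuppAntidiag_nat_eq_multichoose (s := (Finset.univ : Finset (Fin k))) t
  rw [Finset.card_univ, Fintype.card_fin] at h
  rw [← h, Finset.finsuppAntidiag, Finset.card_map, Finset.card_attach]

theorem multichoose_eq_choose_pred {k : ℕ} (hk : 1 ≤ k) (t : ℕ) :
    k.multichoose t = (t + k - 1).choose (k - 1) := by
  rw [Nat.multichoose_eq, add_comm k, ← Nat.choose_symm (by omega)]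
  congr 1
  omega

end MinPlus

section MomentGeneratingFunctions

open ProbabilityTheory

variable {Ω : Type*} [MeasurableSpace Ω] {μ : Measure Ω}

theorem exp_sum_mul_le {ι : Type*} [Fintype ι] {w : ι → ℝ} (hw : ∀ j, 0 ≤ w j)
    (hw_sum : ∑ j, w j = 1) (z b : ι → ℝ) :
    Real.exp (∑ j, w j * z j) ≤
      Real.exp (∑ j, w j * b j) * ∑ j, w j * Real.exp (z j - b j) := by
  have hconvex := convexOn_exp.map_sum_le (t := Finset.univ) (w := w) (p := fun j => z j - b j)
    (fun j _ => hw j) hw_sum fun j _ => Set.mem_univ _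
  have hsplit : ∑ j, w j * z j = ∑ j, w j * b j + ∑ j, w j * (z j - b j) := by
    rw [← Finset.sum_add_distrib]
    exact Finset.sum_congr rfl fun j _ => by ring
  rw [hsplit, Real.exp_add]
  gcongr
  exact hconvex

theorem integrable_exp_sum_mul {ι : Type*} [Fintype ι] {w : ι → ℝ} (hw : ∀ j, 0 ≤ w j)
    (hw_sum : ∑ j, w j = 1) {Z : ι → Ω → ℝ} (hZ : ∀ j, Integrable (fun ω => Real.exp (Z j ω)) μ) :
    Integrable (fun ω => Real.exp (∑ j, w j * Z j ω)) μ := by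
  have hmeas (j : ι) : AEMeasurable (Z j) μ :=
    Real.aemeasurable_of_aemeasurable_exp (hZ j).aemeasurable
  refine (integrable_finsetSum Finset.univ fun j _ => (hZ j).const_mul (w j)).mono'
    (Finset.aemeasurable_fun_sum _ fun j _ => (hmeas j).const_mul _).exp.aestronglyMeasurable
    (ae_of_all _ fun ω => ?_)
  rw [Real.norm_of_nonneg (Real.exp_pos _).le]
  simpa using exp_sum_mul_le hw hw_sum (fun j => Z j ω) 0

theorem integral_exp_sum_mul_le {ι : Type*} [Fintype ι] {w : ι → ℝ} (hw : ∀ j, 0 ≤ w j)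
    (hw_sum : ∑ j, w j = 1) {Z : ι → Ω → ℝ} (hZ : ∀ j, Integrable (fun ω => Real.exp (Z j ω)) μ)
    {b : ι → ℝ} (hb : ∀ j, ∫ ω, Real.exp (Z j ω) ∂μ ≤ Real.exp (b j)) :
    ∫ ω, Real.exp (∑ j, w j * Z j ω) ∂μ ≤ Real.exp (∑ j, w j * b j) := by
  have hZb (j : ι) : Integrable (fun ω => Real.exp (Z j ω - b j)) μ := by
    simpa only [Real.exp_sub] using (hZ j).div_const _
  have hterm (j : ι) : ∫ ω, Real.exp (Z j ω - b j) ∂μ ≤ 1 := by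
    simpa only [Real.exp_sub, integral_div] using (div_le_one (Real.exp_pos _)).2 (hb j)
  calc ∫ ω, Real.exp (∑ j, w j * Z j ω) ∂μ
      ≤ ∫ ω, Real.exp (∑ j, w j * b j) * ∑ j, w j * Real.exp (Z j ω - b j) ∂μ :=
        integral_mono (integrable_exp_sum_mul hw hw_sum hZ)
          ((integrable_finsetSum _ fun j _ => (hZb j).const_mul _).const_mul _)
          fun ω => exp_sum_mul_le hw hw_sum (fun j => Z j ω) b
    _ = Real.exp (∑ j, w j * b j) * ∑ j, w j * ∫ ω, Real.exp (Z j ω - b j) ∂μ := by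
        rw [integral_const_mul, integral_finsetSum _ fun j _ => (hZb j).const_mul _]
        simp only [integral_const_mul]
    _ ≤ Real.exp (∑ j, w j * b j) * ∑ j, w j * 1 := by
        gcongr with j
        exacts [hw j, hterm j]
    _ = Real.exp (∑ j, w j * b j) := by simp only [mul_one, hw_sum]

/-- The random service `S ω s t` has moment generating function at `y` at most `exp(y r (t - s))`
over every interval `[s, t]`. For `y < 0` the rate `r` bounds the service from below, for `y > 0`
from above. -/
structure HasMGFRate (μ : Measure Ω) (S : Ω → ℕ → ℕ → ℝ) (y r : ℝ) : Prop where
  integrable_exp : ∀ ⦃s t⦄, s ≤ t → Integrable (fun ω => Real.exp (y * S ω s t)) μ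
  mgf_le : ∀ ⦃s t⦄, s ≤ t → mgf (fun ω => S ω s t) μ y ≤ Real.exp (y * r * ((t : ℝ) - s))

theorem HasMGFRate.mono {S : Ω → ℕ → ℕ → ℝ} {y r r' : ℝ} (h : HasMGFRate μ S y r)
    (hr : y * r ≤ y * r') : HasMGFRate μ S y r' where
  integrable_exp := h.integrable_exp
  mgf_le _ _ hst := (h.mgf_le hst).trans <| Real.exp_le_exp.2 <|
    mul_le_mul_of_nonneg_right hr (sub_nonneg.2 (Nat.cast_le.2 hst))

section Hops

variable {k : ℕ} {S : Fin k → Ω → ℕ → ℕ → ℝ} {r : ℝ}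

theorem integrable_exp_pathService (hk : k ≠ 0) {y : ℝ}
    (h : ∀ j, HasMGFRate μ (S j) (k * y) r) (d : Fin k → ℕ) :
    Integrable (fun ω => Real.exp (y * pathService (fun j => S j ω) d)) μ := by
  simp only [mul_pathService hk]
  exact integrable_exp_sum_mul (fun _ => by positivity) (by simp [hk]) fun j =>
    (h j).integrable_exp (partialSum_castSucc_le_succ d j)

theorem mgf_pathService_le (hk : k ≠ 0) {y : ℝ} (h : ∀ j, HasMGFRate μ (S j) (k * y) r)
    (d : Fin k → ℕ) :
    mgf (fun ω => pathService (fun j => S j ω) d) μ y ≤ Real.exp (y * r * (∑ j, d j : ℕ)) := by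
  simp only [mgf, mul_pathService hk]
  refine (integral_exp_sum_mul_le (fun _ => by positivity) (by simp [hk])
    (fun j => (h j).integrable_exp (partialSum_castSucc_le_succ d j))
    fun j => (h j).mgf_le (partialSum_castSucc_le_succ d j)).trans_eq (congrArg Real.exp ?_)
  rw [Nat.cast_sum, Finset.mul_sum]
  refine Finset.sum_congr rfl fun j _ => ?_
  rw [Fin.partialSum_succ, Nat.cast_add, add_sub_cancel_left]
  field_simp

variable [IsFiniteMeasure μ] {θ : ℝ}

theorem measureReal_departures_le_le (hk : k ≠ 0) (hθ : 0 ≤ θ)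
    (h : ∀ j, HasMGFRate μ (S j) (-(k * θ)) r) (t : ℕ) (x : ℝ) :
    μ.real {ω | departures saturatedArrivals k (fun j => S j ω) t ≤ x} ≤
      k.multichoose t * Real.exp (θ * (x - r * t)) := by
  simp only [← mul_neg] at h
  let paths := Finset.piAntidiag (Finset.univ : Finset (Fin k)) t
  have hpath (d : Fin k → ℕ) (hd : d ∈ paths) :
      μ.real {ω | pathService (fun j => S j ω) d ≤ x} ≤ Real.exp (θ * (x - r * t)) := by
    have hmgf := mgf_pathService_le hk h d
    rw [(Finset.mem_piAntidiag.1 hd).1] at hmgf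
    calc μ.real {ω | pathService (fun j => S j ω) d ≤ x}
        ≤ Real.exp (- -θ * x) * mgf (fun ω => pathService (fun j => S j ω) d) μ (-θ) :=
          measure_le_le_exp_mul_mgf x (neg_nonpos.2 hθ) (integrable_exp_pathService hk h d)
      _ ≤ Real.exp (- -θ * x) * Real.exp (-θ * r * t) := by gcongr
      _ = Real.exp (θ * (x - r * t)) := by
          rw [← Real.exp_add]
          ring_nf
  have hcover : {ω | departures saturatedArrivals k (fun j => S j ω) t ≤ x} =
      ⋃ d ∈ paths, {ω | pathService (fun j => S j ω) d ≤ x} := by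
    ext ω
    simp [departures_saturated_le_coe_iff, paths]
  calc μ.real {ω | departures saturatedArrivals k (fun j => S j ω) t ≤ x}
      ≤ ∑ d ∈ paths, μ.real {ω | pathService (fun j => S j ω) d ≤ x} :=
        hcover ▸ measureReal_biUnion_finset_le _ _
    _ ≤ paths.card • Real.exp (θ * (x - r * t)) := Finset.sum_le_card_nsmul _ _ _ hpath
    _ = k.multichoose t * Real.exp (θ * (x - r * t)) := by
        rw [card_piAntidiag_univ_nat, nsmul_eq_mul]

theorem measureReal_le_departures_le (hk : k ≠ 0) (hθ : 0 ≤ θ)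
    (h : ∀ j, HasMGFRate μ (S j) (k * θ) r) (t : ℕ) (x : ℝ) :
    μ.real {ω | (x : EReal) ≤ departures saturatedArrivals k (fun j => S j ω) t} ≤
      Real.exp (-(θ * (x - r * t))) := by
  obtain ⟨d, hd⟩ : ∃ d : Fin k → ℕ, ∑ j, d j = t :=
    ⟨Pi.single ⟨0, Nat.pos_of_ne_zero hk⟩ t, Fintype.sum_pi_single' _ _⟩
  have hsub : {ω | (x : EReal) ≤ departures saturatedArrivals k (fun j => S j ω) t} ⊆
      {ω | x ≤ pathService (fun j => S j ω) d} := fun ω hω =>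
    EReal.coe_le_coe_iff.1 (le_trans hω (departures_saturated_le_coe_iff.2 ⟨d, hd, le_rfl⟩))
  calc μ.real {ω | (x : EReal) ≤ departures saturatedArrivals k (fun j => S j ω) t}
      ≤ μ.real {ω | x ≤ pathService (fun j => S j ω) d} := measureReal_mono hsub
    _ ≤ Real.exp (-θ * x) * mgf (fun ω => pathService (fun j => S j ω) d) μ θ :=
        measure_ge_le_exp_mul_mgf x hθ (integrable_exp_pathService hk h d)
    _ ≤ Real.exp (-θ * x) * Real.exp (θ * r * t) := by
        gcongr
        exact hd ▸ mgf_pathService_le hk h d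
    _ = Real.exp (-(θ * (x - r * t))) := by
        rw [← Real.exp_add]
        ring_nf

end Hops

end MomentGeneratingFunctions

section Limits

variable {Ω ι : Type*} [MeasurableSpace Ω] {μ : Measure Ω} [Nonempty ι]

theorem measure_lt_iSup_le {α : Type*} [CompleteLinearOrder α] [TopologicalSpace α]
    [OrderTopology α] [FirstCountableTopology α] {D : Ω → α} {u : ι → α} {c : ENNReal}
    (h : ∀ i, μ {ω | D ω ≤ u i} ≤ c) : μ {ω | D ω < ⨆ i, u i} ≤ c := by
  obtain ⟨v, hv_mono, hv_lim, hv_mem⟩ :=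
    exists_seq_tendsto_sSup (Set.range_nonempty u) (OrderTop.bddAbove _)
  have hmono : Monotone fun n => {ω | D ω ≤ v n} := fun m n hmn ω hω => le_trans hω (hv_mono hmn)
  have hsub : {ω | D ω < ⨆ i, u i} ⊆ ⋃ n, {ω | D ω ≤ v n} := fun ω hω =>
    Set.mem_iUnion.2 ((hv_lim.eventually_const_lt hω).exists.imp fun _ => le_of_lt)
  refine (measure_mono hsub).trans ?_
  rw [hmono.measure_iUnion]
  refine iSup_le fun n => ?_
  obtain ⟨i, hi⟩ := hv_mem n
  exact hi ▸ h i

theorem measure_iInf_lt_le {α : Type*} [CompleteLinearOrder α] [TopologicalSpace α]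
    [OrderTopology α] [FirstCountableTopology α] {D : Ω → α} {u : ι → α} {c : ENNReal}
    (h : ∀ i, μ {ω | u i ≤ D ω} ≤ c) : μ {ω | ⨅ i, u i < D ω} ≤ c :=
  measure_lt_iSup_le (α := αᵒᵈ) h

variable [IsFiniteMeasure μ] {D : Ω → EReal} {u : ι → ℝ} {c : ℝ} {t : ℕ}

theorem measureReal_lt_iSup_mul_le (ht : t ≠ 0)
    (h : ∀ i, μ.real {ω | D ω ≤ ((u i * t : ℝ) : EReal)} ≤ c) :
    μ.real {ω | D ω < (⨆ i, (u i : EReal)) * (t : EReal)} ≤ c := by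
  have ht_pos : (0 : EReal) < t := by exact_mod_cast Nat.pos_of_ne_zero ht
  have ht_top : (t : EReal) ≠ ⊤ := EReal.natCast_ne_top t
  have hc : 0 ≤ c := (measureReal_nonneg (μ := μ)).trans (h (Classical.arbitrary ι))
  simp only [← EReal.div_lt_iff ht_pos ht_top]
  refine ENNReal.toReal_le_of_le_ofReal hc (measure_lt_iSup_le fun i => ?_)
  simp only [EReal.div_le_iff_le_mul ht_pos ht_top]
  rw [ENNReal.le_ofReal_iff_toReal_le (measure_ne_top _ _) hc]
  simpa [Measure.real, mul_comm] using h i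

theorem measureReal_iInf_mul_lt_le (ht : t ≠ 0)
    (h : ∀ i, μ.real {ω | ((u i * t : ℝ) : EReal) ≤ D ω} ≤ c) :
    μ.real {ω | (⨅ i, (u i : EReal)) * (t : EReal) < D ω} ≤ c := by
  have ht_pos : (0 : EReal) < t := by exact_mod_cast Nat.pos_of_ne_zero ht
  have ht_top : (t : EReal) ≠ ⊤ := EReal.natCast_ne_top t
  have hc : 0 ≤ c := (measureReal_nonneg (μ := μ)).trans (h (Classical.arbitrary ι))
  simp only [← EReal.lt_div_iff ht_pos ht_top]
  refine ENNReal.toReal_le_of_le_ofReal hc (measure_iInf_lt_le fun i => ?_)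
  simp only [EReal.le_div_iff_mul_le ht_pos ht_top]
  rw [ENNReal.le_ofReal_iff_toReal_le (measure_ne_top _ _) hc]
  simpa [Measure.real] using h i

end Limits

section CapacityBounds

open Matrix ProbabilityTheory

/-- The exponential growth rate `Λ(y) / y` of the additive functional of `f` over a chain with
generator `P`, where `Λ(y)` is the largest eigenvalue of the tilted generator `P + y diag(f)`. -/
noncomputable def growthRate {E : Type*} [Fintype E] [DecidableEq E] (P : Matrix E E ℝ)
    (f : E → ℝ) (y : ℝ) : ℝ :=
  topEigenvalue (P + diagonal (y • f)) / y

/-- The analogue of `lowerRateAt` for hops whose transmission rates are arbitrary functions `f j` of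
the state of the chain. -/
noncomputable def spectralLowerRateAt {E : Type*} [Fintype E] [DecidableEq E] {k : ℕ}
    (P : Matrix E E ℝ) (f : Fin k → E → ℝ) (ε : ℝ) (t : ℕ) (θ : ℝ) : ℝ :=
  (⨅ j, growthRate P (f j) (-(k * θ))) +
    (Real.log ε - Real.log ((t + k - 1).choose (k - 1))) / (θ * t)

/-- The analogue of `upperRateAt` for hops whose transmission rates are arbitrary functions `f j` of
the state of the chain. -/
noncomputable def spectralUpperRateAt {E : Type*} [Fintype E] [DecidableEq E] {k : ℕ}
    (P : Matrix E E ℝ) (f : Fin k → E → ℝ) (ε : ℝ) (t : ℕ) (θ : ℝ) : ℝ :=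
  (⨆ j, growthRate P (f j) (k * θ)) - Real.log ε / (θ * t)

/-- The cumulative end-to-end departures at time `t` of a saturated flow that crosses `k` hops, the
`j`-th of which transmits at rate `f j i` while the chain `X` is in state `i`. -/
noncomputable def modulatedDepartures {Ω E : Type*} {k : ℕ} (X : ℝ≥0 → Ω → E) (f : Fin k → E → ℝ)
    (t : ℕ) (ω : Ω) : EReal :=
  departures saturatedArrivals k (fun j s t => additiveFunctional X (f j) ω s t) t

variable {Ω E : Type*} [MeasurableSpace Ω] [Fintype E] [DecidableEq E] {μ : Measure Ω}
  [IsFiniteMeasure μ] {P : Matrix E E ℝ} {p : E → ℝ} {X : ℝ≥0 → Ω → E}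

theorem IsMarkovChain.hasMGFRate (hX : IsMarkovChain μ P p X) (hp : IsReversibleDistribution P p)
    (f : E → ℝ) {y : ℝ} (hy : y ≠ 0) :
    HasMGFRate μ (fun ω s t => additiveFunctional X f ω s t) y (growthRate P f y) where
  integrable_exp s t hst := by
    simp only [← additiveFunctional_smul]
    exact hX.integrable_exp_additiveFunctional _ (Nat.cast_le.2 hst)
  mgf_le s t hst := by
    simp only [mgf, ← additiveFunctional_smul]
    rw [growthRate, mul_div_cancel₀ _ hy, mul_comm]
    exact hX.integral_exp_additiveFunctional_le hp _ s.cast_nonneg (Nat.cast_le.2 hst)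

variable {k : ℕ} {ε : ℝ} {t : ℕ} {θ : ℝ}

theorem IsMarkovChain.measureReal_modulatedDepartures_le_le (hX : IsMarkovChain μ P p X)
    (hp : IsReversibleDistribution P p) (hk : 1 ≤ k) (f : Fin k → E → ℝ) (hε : 0 < ε) (ht : 1 ≤ t)
    (hθ : 0 < θ) :
    μ.real {ω | modulatedDepartures X f t ω ≤ ((spectralLowerRateAt P f ε t θ * t : ℝ) : EReal)}
      ≤ ε := by
  set r := ⨅ j, growthRate P (f j) (-(k * θ)) with hr
  set N := (t + k - 1).choose (k - 1) with hN
  have hy : 0 < k * θ := by positivity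
  have hrate (j : Fin k) :
      HasMGFRate μ (fun ω s t => additiveFunctional X (f j) ω s t) (-(k * θ)) r :=
    (hX.hasMGFRate hp (f j) (neg_ne_zero.2 hy.ne')).mono <|
      mul_le_mul_of_nonpos_left (ciInf_le (Set.finite_range _).bddBelow j) (neg_nonpos.2 hy.le)
  have hN_pos : (0 : ℝ) < N := Nat.cast_pos.2 (Nat.choose_pos (by omega))
  have hexponent : θ * (spectralLowerRateAt P f ε t θ * t - r * t) = Real.log (ε / N) := by
    rw [spectralLowerRateAt, ← hr, ← hN, Real.log_div hε.ne' hN_pos.ne']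
    field_simp
    ring
  refine (measureReal_departures_le_le (by omega) hθ.le hrate t _).trans_eq ?_
  rw [hexponent, Real.exp_log (div_pos hε hN_pos), multichoose_eq_choose_pred hk,
    mul_div_cancel₀ _ hN_pos.ne']

theorem IsMarkovChain.measureReal_le_modulatedDepartures_le (hX : IsMarkovChain μ P p X)
    (hp : IsReversibleDistribution P p) (hk : 1 ≤ k) (f : Fin k → E → ℝ) (hε : 0 < ε) (ht : 1 ≤ t)
    (hθ : 0 < θ) :
    μ.real {ω | ((spectralUpperRateAt P f ε t θ * t : ℝ) : EReal) ≤ modulatedDepartures X f t ω}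
      ≤ ε := by
  set r := ⨆ j, growthRate P (f j) (k * θ) with hr
  have hy : 0 < k * θ := by positivity
  have hrate (j : Fin k) :
      HasMGFRate μ (fun ω s t => additiveFunctional X (f j) ω s t) (k * θ) r :=
    (hX.hasMGFRate hp (f j) hy.ne').mono <|
      mul_le_mul_of_nonneg_left
        (le_ciSup (f := fun j => growthRate P (f j) (k * θ)) (Set.finite_range _).bddAbove j) hy.le
  have hexponent : -(θ * (spectralUpperRateAt P f ε t θ * t - r * t)) = Real.log ε := by
    rw [spectralUpperRateAt, ← hr]
    field_simp
    ring
  refine (measureReal_le_departures_le (by omega) hθ.le hrate t _).trans_eq ?_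
  rw [hexponent, Real.exp_log hε]

theorem theorem2_general (hX : IsMarkovChain μ P p X) (hp : IsReversibleDistribution P p)
    (hk : 1 ≤ k) (f : Fin k → E → ℝ) (hε : 0 < ε) (ht : 1 ≤ t) :
    ((∀ θ : ℝ, 0 < θ → μ.real
        {ω | modulatedDepartures X f t ω ≤ ((spectralLowerRateAt P f ε t θ * t : ℝ) : EReal)}
          ≤ ε) ∧
      μ.real {ω | modulatedDepartures X f t ω <
        (⨆ θ : Set.Ioi (0 : ℝ), (spectralLowerRateAt P f ε t θ : EReal)) * (t : EReal)} ≤ ε) ∧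
    ((∀ θ : ℝ, 0 < θ → μ.real
        {ω | ((spectralUpperRateAt P f ε t θ * t : ℝ) : EReal) ≤ modulatedDepartures X f t ω}
          ≤ ε) ∧
      μ.real {ω | (⨅ θ : Set.Ioi (0 : ℝ), (spectralUpperRateAt P f ε t θ : EReal)) * (t : EReal) <
        modulatedDepartures X f t ω} ≤ ε) := by
  have hlower (θ : ℝ) (hθ : 0 < θ) := hX.measureReal_modulatedDepartures_le_le hp hk f hε ht hθ
  have hupper (θ : ℝ) (hθ : 0 < θ) := hX.measureReal_le_modulatedDepartures_le hp hk f hε ht hθ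
  have ht_ne : t ≠ 0 := by omega
  exact ⟨⟨hlower, measureReal_lt_iSup_mul_le ht_ne fun θ => hlower θ θ.2⟩,
    hupper, measureReal_iInf_mul_lt_le ht_ne fun θ => hupper θ θ.2⟩

end CapacityBounds

section OnOffHops

variable {E : Type*} [Fintype E] [DecidableEq E]

theorem hopRate_eq_growthRate (P : Matrix E E ℝ) (C : ℝ) (F : Set E) (y : ℝ) :
    hopRate P C F y = growthRate P (mmtpRate C F) y := by
  classical
  have hB : bMatrix P C F (-y) = P + Matrix.diagonal (y • mmtpRate C F) := by
    ext i l
    rcases eq_or_ne i l with rfl | hil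
    · by_cases hF : i ∈ F <;> simp [bMatrix, mmtpRate, hF]
    · simp [bMatrix, hil]
  rw [hopRate, hB, growthRate]

theorem lowerRateAt_eq_spectralLowerRateAt {k : ℕ} (P : Matrix E E ℝ) (C : ℝ) (F : Fin k → Set E)
    (ε : ℝ) (t : ℕ) :
    lowerRateAt P C F ε t = spectralLowerRateAt P (fun j => mmtpRate C (F j)) ε t := by
  funext θ
  simp only [lowerRateAt, spectralLowerRateAt, hopRate_eq_growthRate]

theorem upperRateAt_eq_spectralUpperRateAt {k : ℕ} (P : Matrix E E ℝ) (C : ℝ) (F : Fin k → Set E)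
    (ε : ℝ) (t : ℕ) :
    upperRateAt P C F ε t = spectralUpperRateAt P (fun j => mmtpRate C (F j)) ε t := by
  funext θ
  simp only [upperRateAt, spectralUpperRateAt, hopRate_eq_growthRate]

end OnOffHops

theorem theorem2 {Ω E : Type*} [MeasurableSpace Ω] [Fintype E] [DecidableEq E]
    (μ : Measure Ω) [IsProbabilityMeasure μ]
    (P : Matrix E E ℝ) (hP : IsGenerator P)
    (p : E → ℝ) (hp : IsReversibleDistribution P p)
    (X : ℝ≥0 → Ω → E) (hX : IsMarkovChain μ P p X)
    (C : ℝ) (hC : 0 < C)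
    (k : ℕ) (hk : 1 ≤ k) (F : Fin k → Set E)
    (ε : ℝ) (hε : 0 < ε) (t : ℕ) (ht : 1 ≤ t) :
    ((∀ θ : ℝ, 0 < θ →
        μ.real {ω | endToEnd X C F t ω ≤ ((lowerRateAt P C F ε t θ * t : ℝ) : EReal)} ≤ ε) ∧
      μ.real {ω | endToEnd X C F t ω < lowerRate P C F ε t * (t : EReal)} ≤ ε) ∧
    ((∀ θ : ℝ, 0 < θ →
        μ.real {ω | ((upperRateAt P C F ε t θ * t : ℝ) : EReal) ≤ endToEnd X C F t ω} ≤ ε) ∧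
      μ.real {ω | upperRate P C F ε t * (t : EReal) < endToEnd X C F t ω} ≤ ε) := by
  rw [lowerRate, upperRate, lowerRateAt_eq_spectralLowerRateAt, upperRateAt_eq_spectralUpperRateAt]
  exact theorem2_general hX hp hk (fun j => mmtpRate C (F j)) hε ht
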